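/- **Setting.** Let $d\ge 1$, $\alpha>d$, $\lambda>0$, let $W$ be a random variable with $\mathbb P(W\ge 1)=1$, and let $L$ be a random variable with distribution function $F_L(t)=\mathbb P(L\le t)$. The weighted scale-free percolation $\mathrm{SFP}_{W,L}$ on $\mathbb Z^d$ is the following random weighted graph. The vertices $x\in\mathbb Z^d$ carry i.i.d. vertex-weights $W_x$ distributed as $W$. Any two vertices at Euclidean distance $1$ are joined by an edge. Given $(W_x)_{x\in\mathbb Z^d}$, any two vertices $x,y$ with $\|x-y\|>1$ are joined, independently of all other pairs, with probability $1-\exp\{-\lambda W_xW_y/\|x-y\|^\alpha\}$. The edges $e$ carry i.i.d. edge-weights $L_e$ distributed as $L$, independent of the graph and of the vertex-weights. Let $\mathrm d_L(x,y)$ be the infimum of $\sum_{e\in\pi}L_e$ over all paths $\pi$ from $x$ to $y$, let $B^L_t(x)=\{y\in\mathbb Z^d:\mathrm d_L(x,y)\le t\}$ for $t\ge 0$, and let $$\tau_n(x)=\inf\{t\ge 0:|B^L_t(x)|=n\},\qquad \tau^{\ge}_n(x)=\inf\{t\ge 0:|B^L_t(x)|\ge n\}\qquad(\inf\emptyset=\infty).$$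 **Assumptions.** $F_L(0)=0$, and $W$ has tail parameter $\gamma>2$, that is, either $\mathbb P(W>t)=\ell(t)/t^{\tau-1}$ for all $t>0$, with some $\tau>1$ such that $\gamma:=\alpha(\tau-1)/d>2$ and some function $\ell$ varying slowly at infinity ($\lim_{t\to\infty}\ell(ct)/\ell(t)=1$ for every $c>0$), or the tail of $W$ is thinner than every power law: $\lim_{t\to\infty}t^s\,\mathbb P(W>t)=0$ for every $s>0$. **Claim.** There are deterministic constants $C,c>0$, depending only on $d,\alpha,\lambda$ and the distributions of $W$ and $L$, such that for every $x\in\mathbb Z^d$, almost surely: 1. there is a (random) $t_0$ such that $B^L_t(x)$ is finite and $|B_t^L(x)|\le e^{Ct}$ for all $t\ge t_0$; 2. there is a (random) $n_0$ such that $\tau_n(x)\ge c\log n$ and $\tau^{\ge}_n(x)\ge c\log n$ for all $n\ge n_0$; 3. $\tau_n(x)\to\infty$ and $\tau_n^{\ge}(x)\to\infty$ as $n\to\infty$; 4. explosion does not occur: $B_t^L(x)$ is finite for every $t<\infty$. -/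

import Mathlib

open MeasureTheory ProbabilityTheory Filter Topology Set
open scoped NNReal ENNReal

universe u

namespace SFP

/-- The vertex set `ℤ^d`. -/
abbrev Lattice (d : ℕ) : Type := Fin d → ℤ

/-- Euclidean distance of two lattice points. -/
noncomputable def eucl {d : ℕ} (x y : Lattice d) : ℝ :=
  Real.sqrt (∑ i, ((x i : ℝ) - (y i : ℝ)) ^ 2)

theorem eucl_comm {d : ℕ} (x y : Lattice d) : eucl x y = eucl y x := by
  unfold eucl
  congr 1
  exact Finset.sum_congr rfl fun i _ => by ring

/-- The two end points of the unordered pair `e` are at Euclidean distance larger than one. -/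
def IsLong {d : ℕ} (e : Sym2 (Lattice d)) : Prop :=
  ∃ x y, e = s(x, y) ∧ 1 < eucl x y

/-- The probability `1 - exp (-lam * w x * w y / ‖x - y‖ ^ α)` that the pair `e = {x, y}` is an
edge, given the vertex-weights `w`. -/
noncomputable def edgeProb {d : ℕ} (α lam : ℝ) (w : Lattice d → ℝ) : Sym2 (Lattice d) → ℝ :=
  Sym2.lift ⟨fun x y => 1 - Real.exp (-(lam * (w x * w y) / eucl x y ^ α)), fun x y => by
    simp only [eucl_comm x y, mul_comm (w x) (w y)]⟩

/-- The σ-algebra generated by the vertex-weights. -/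
abbrev sigmaWeights {Ω : Type u} {d : ℕ} (W : Lattice d → Ω → ℝ) : MeasurableSpace Ω :=
  ⨆ x, MeasurableSpace.comap (W x) inferInstance

/-- The σ-algebra generated by the random graph. -/
abbrev sigmaGraph {Ω : Type u} {d : ℕ} (G : Ω → SimpleGraph (Lattice d)) : MeasurableSpace Ω :=
  MeasurableSpace.generateFrom {s | ∃ x y, s = {ω | (G ω).Adj x y}}

/-- The σ-algebra generated by the edge-weights. -/
abbrev sigmaLengths {Ω : Type u} {d : ℕ} (L : Sym2 (Lattice d) → Ω → ℝ) : MeasurableSpace Ω :=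
  ⨆ e, MeasurableSpace.comap (L e) inferInstance

/-- `(W, G, L)`, defined on the probability space `(Ω, μ)`, is a scale-free percolation on `ℤ^d`
with long-range parameter `α`, percolation parameter `lam`, vertex-weight distribution `νW` and
edge-weight distribution `νL`. The fields prescribe exactly the joint law: the vertex-weights are
i.i.d.; nearest neighbours are joined; given the vertex-weights, the other pairs are edges
independently of each other with the probabilities `edgeProb`; the edge-weights are i.i.d. and
independent of the vertex-weights and the graph. An edge-weight is attached to every unordered
pair, but only those of the edges of the graph are ever used. -/
structure IsScaleFreePercolation {Ω : Type u} [MeasurableSpace Ω] (μ : Measure Ω) {d : ℕ}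
    (α lam : ℝ) (νW νL : Measure ℝ) (W : Lattice d → Ω → ℝ) (G : Ω → SimpleGraph (Lattice d))
    (L : Sym2 (Lattice d) → Ω → ℝ) : Prop where
  measurable_weight : ∀ x, Measurable (W x)
  law_weight : ∀ x, μ.map (W x) = νW
  indep_weight : iIndepFun W μ
  measurable_adj : ∀ x y, MeasurableSet {ω | (G ω).Adj x y}
  nearest : ∀ᵐ ω ∂μ, ∀ x y, eucl x y = 1 → (G ω).Adj x y
  cond_edges : ∀ F : Finset (Sym2 (Lattice d)), (∀ e ∈ F, IsLong e) →
    μ[Set.indicator {ω | ∀ e ∈ F, e ∈ (G ω).edgeSet} (fun _ => (1 : ℝ)) | sigmaWeights W]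
      =ᵐ[μ] fun ω => ∏ e ∈ F, edgeProb α lam (fun x => W x ω) e
  measurable_length : ∀ e, Measurable (L e)
  law_length : ∀ e, μ.map (L e) = νL
  indep_length : iIndepFun L μ
  indep_graph_length : Indep (sigmaWeights W ⊔ sigmaGraph G) (sigmaLengths L) μ

/-- `ℓ` varies slowly at infinity. -/
def SlowlyVarying (ℓ : ℝ → ℝ) : Prop :=
  ∀ c : ℝ, 0 < c → Tendsto (fun t => ℓ (c * t) / ℓ t) atTop (𝓝 1)

/-- `ν` has a power-law tail with exponent `τ`: `ν (t, ∞) = ℓ t / t ^ (τ - 1)` with `ℓ` slowly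
varying. -/
def IsPowerLaw (ν : Measure ℝ) (τ : ℝ) : Prop :=
  ∃ ℓ : ℝ → ℝ, SlowlyVarying ℓ ∧ ∀ t : ℝ, 0 < t → ν.real (Ioi t) = ℓ t / t ^ (τ - 1)

/-- The tail of `ν` is thinner than every power law. -/
def IsThinTailed (ν : Measure ℝ) : Prop :=
  ∀ s : ℝ, 0 < s → Tendsto (fun t : ℝ => t ^ s * ν.real (Ioi t)) atTop (𝓝 0)

/-- The total edge-weight of a walk. Edge-weights are almost surely positive, so `ENNReal.ofReal`
changes them at most on a null set. -/
noncomputable def walkLength {V : Type*} {G : SimpleGraph V} (L : Sym2 V → ℝ) {x y : V}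
    (p : G.Walk x y) : ℝ≥0∞ :=
  (p.edges.map fun e => ENNReal.ofReal (L e)).sum

/-- The `L`-distance: the infimum of the total edge-weight over the paths from `x` to `y`. -/
noncomputable def distL {V : Type*} (G : SimpleGraph V) (L : Sym2 V → ℝ) (x y : V) : ℝ≥0∞ :=
  ⨅ p : G.Path x y, walkLength L (p : G.Walk x y)

/-- The ball of radius `t` around `x` for the `L`-distance. -/
def ballL {V : Type*} (G : SimpleGraph V) (L : Sym2 V → ℝ) (x : V) (t : ℝ≥0) : Set V :=
  {y | distL G L x y ≤ t}

/-- `inf {t : |B_t(x)| = n}`, with `inf ∅ = ∞`. -/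
noncomputable def hitTime {V : Type*} (G : SimpleGraph V) (L : Sym2 V → ℝ) (x : V) (n : ℕ) :
    ℝ≥0∞ :=
  ⨅ (t : ℝ≥0) (_ : (ballL G L x t).encard = n), (t : ℝ≥0∞)

/-- `inf {t : |B_t(x)| ≥ n}`, with `inf ∅ = ∞`; this differs from `hitTime` only if the size of the
ball jumps over `n`. -/
noncomputable def passTime {V : Type*} (G : SimpleGraph V) (L : Sym2 V → ℝ) (x : V) (n : ℕ) :
    ℝ≥0∞ :=
  ⨅ (t : ℝ≥0) (_ : (n : ℕ∞) ≤ (ballL G L x t).encard), (t : ℝ≥0∞)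

end SFP

/-!
Let `Z` be the sum of `exp (-θ |π|_L)` over all self-avoiding paths `π` starting at `x`. Every
vertex of `B_t(x)` is the end point of a path of length at most `t + 1`, so
`|B_t(x)| ≤ Z exp (θ (t + 1))`, and it suffices to find `θ` with `E Z < ∞`.

Choose `s ≤ 1` with `α s > d` and `E W ^ (2 s) < ∞`, which `γ > 2` permits. Since
`1 - exp (-z) ≤ z ^ s`, an edge probability is at most a constant times
`‖x - y‖ ^ (-α s) W_x ^ s W_y ^ s`. A self-avoiding path meets each of its vertices in at most two
edges, so the probability that it is present is at most a product over its edges of a kernel with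
finite mass `A`, times one factor `M`, essentially `E W ^ (2 s)`, for each vertex. Hence `E Z` is
bounded by a geometric series of ratio `A M E exp (-θ L)`, which is less than `1` for large `θ`
because `L > 0` almost surely.
-/

namespace SFP

section Walks

variable {V : Type*} {G : SimpleGraph V}

theorem support_tail_injective (G : SimpleGraph V) (x : V) :
    Function.Injective fun p : Σ y, G.Walk x y => p.2.support.tail := by
  rintro ⟨y, p⟩ ⟨z, q⟩ hpq
  have hsupport : p.support = q.support := by
    rw [← p.cons_tail_support, ← q.cons_tail_support]
    exact congrArg _ hpq
  obtain rfl : y = z := by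
    rw [← p.getLast_support, ← q.getLast_support]
    simp only [hsupport]
  rw [SimpleGraph.Walk.ext_support hsupport]

instance countable_sigma_path [Countable V] (G : SimpleGraph V) (x : V) :
    Countable (Σ y, G.Path x y) :=
  ((support_tail_injective G x).comp
    (Function.injective_id.sigma_map fun _ => Subtype.val_injective)).countable

theorem mul_prod_edges_le_prod_support_sq {M : Type*} [CommMonoid M] [Preorder M] [MulLeftMono M]
    {u : V → M} (hu : ∀ v, 1 ≤ u v) {x y : V} (p : G.Walk x y) :
    u x * (p.edges.map fun e => (e.map u).mul).prod ≤ (p.support.map fun v => u v ^ 2).prod := by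
  induction p with
  | nil => simpa [sq] using le_mul_of_one_le_left' (hu _)
  | @cons x z y h p ih =>
    calc u x * ((SimpleGraph.Walk.cons h p).edges.map fun e => (e.map u).mul).prod
        = u x ^ 2 * (u z * (p.edges.map fun e => (e.map u).mul).prod) := by
          simp only [SimpleGraph.Walk.edges_cons, List.map_cons, List.prod_cons, Sym2.map_mk,
            Sym2.mul_mk, sq, mul_assoc]
      _ ≤ u x ^ 2 * (p.support.map fun v => u v ^ 2).prod := mul_le_mul_right ih _
      _ = ((SimpleGraph.Walk.cons h p).support.map fun v => u v ^ 2).prod := by simp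

/-- The unordered pairs of successive vertices of the sequence `x :: l`. -/
def chainEdges (x : V) (l : List V) : List (Sym2 V) :=
  List.zipWith (s(·, ·)) (x :: l) l

theorem edges_eq_chainEdges {x y : V} (p : G.Walk x y) :
    p.edges = chainEdges x p.support.tail := by
  rw [chainEdges, p.cons_tail_support, p.edges_eq_zipWith_support]

theorem tsum_fin_prod_chainEdges_le {k : Sym2 V → ℝ≥0∞} {A : ℝ≥0∞}
    (hA : ∀ x, ∑' y, k s(x, y) ≤ A) (n : ℕ) (x : V) :
    ∑' v : Fin n → V, ((chainEdges x (List.ofFn v)).map k).prod ≤ A ^ n := by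
  induction n generalizing x with
  | zero => simp [chainEdges]
  | succ n ih =>
    calc ∑' v : Fin (n + 1) → V, ((chainEdges x (List.ofFn v)).map k).prod
        = ∑' y, k s(x, y) * ∑' v : Fin n → V, ((chainEdges y (List.ofFn v)).map k).prod := by
          rw [← (Fin.consEquiv fun _ : Fin (n + 1) => V).tsum_eq, ENNReal.tsum_prod']
          simp [Fin.consEquiv, chainEdges, ENNReal.tsum_mul_left]
      _ ≤ ∑' y, k s(x, y) * A ^ n := by gcongr with y; exact ih y
      _ ≤ A ^ (n + 1) := by
          rw [ENNReal.tsum_mul_right, pow_succ']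
          gcongr
          exact hA x

theorem tsum_walk_prod_edges_le {k : Sym2 V → ℝ≥0∞} {A : ℝ≥0∞}
    (hA : ∀ x, ∑' y, k s(x, y) ≤ A) (G : SimpleGraph V) (x : V) :
    ∑' p : Σ y, G.Walk x y, (p.2.edges.map k).prod ≤ (1 - A)⁻¹ :=
  calc ∑' p : Σ y, G.Walk x y, (p.2.edges.map k).prod
      ≤ ∑' l : List V, ((chainEdges x l).map k).prod := by
        simp only [edges_eq_chainEdges]
        exact ENNReal.tsum_comp_le_tsum_of_injective (support_tail_injective G x)
          fun l => ((chainEdges x l).map k).prod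
    _ = ∑' n, ∑' v : Fin n → V, ((chainEdges x (List.ofFn v)).map k).prod := by
        rw [← List.equivSigmaTuple.symm.tsum_eq, ENNReal.tsum_sigma']
        rfl
    _ ≤ ∑' n, A ^ n := ENNReal.tsum_le_tsum fun n => tsum_fin_prod_chainEdges_le hA n x
    _ = (1 - A)⁻¹ := ENNReal.tsum_geometric A

end Walks

section Discount

variable {V : Type*} {θ : ℝ}

/-- The discount factor `exp (-θ a)` of a length `a`, used at finite lengths only (`a = ⊤` gets the
junk value `1`). -/
noncomputable def discount (θ : ℝ) (a : ℝ≥0∞) : ℝ≥0∞ :=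
  ENNReal.ofReal (Real.exp (-(θ * a.toReal)))

@[fun_prop]
theorem measurable_discount (θ : ℝ) : Measurable (discount θ) := by
  unfold discount
  fun_prop

theorem discount_ne_zero (θ : ℝ) (a : ℝ≥0∞) : discount θ a ≠ 0 := by
  simp [discount, Real.exp_pos]

theorem discount_le_one (hθ : 0 ≤ θ) (a : ℝ≥0∞) : discount θ a ≤ 1 := by
  rw [discount, ENNReal.ofReal_le_one, Real.exp_le_one_iff, neg_nonpos]
  positivity

theorem discount_le_discount (hθ : 0 ≤ θ) {a b : ℝ≥0∞} (hab : a ≤ b) (hb : b ≠ ⊤) :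
    discount θ b ≤ discount θ a := by
  unfold discount
  gcongr

theorem discount_add (θ : ℝ) {a b : ℝ≥0∞} (ha : a ≠ ⊤) (hb : b ≠ ⊤) :
    discount θ (a + b) = discount θ a * discount θ b := by
  rw [discount, discount, discount, ← ENNReal.ofReal_mul (Real.exp_pos _).le, ← Real.exp_add,
    ENNReal.toReal_add ha hb]
  ring_nf

theorem discount_list_sum (θ : ℝ) {l : List ℝ≥0∞} (hl : ∀ a ∈ l, a ≠ ⊤) :
    l.sum ≠ ⊤ ∧ discount θ l.sum = (l.map (discount θ)).prod := by
  induction l with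
  | nil => simp [discount]
  | cons a l ih =>
    obtain ⟨hsum, hprod⟩ := ih fun b hb => hl b (List.mem_cons_of_mem a hb)
    have ha : a ≠ ⊤ := hl a List.mem_cons_self
    simp only [List.sum_cons, List.map_cons, List.prod_cons]
    exact ⟨ENNReal.add_ne_top.2 ⟨ha, hsum⟩, by rw [discount_add θ ha hsum, hprod]⟩

theorem discount_walkLength (θ : ℝ) {G : SimpleGraph V} (L : Sym2 V → ℝ) {x y : V}
    (p : G.Walk x y) :
    discount θ (walkLength L p) =
      (p.edges.map fun e => discount θ (ENNReal.ofReal (L e))).prod := by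
  rw [walkLength, (discount_list_sum θ (by simp)).2, List.map_map]
  rfl

/-- The discount of the length of `p`, a walk of the complete graph, if all edges of `p` are
present in `G`, and `0` otherwise. -/
noncomputable def pathWeight (θ : ℝ) (G : SimpleGraph V) (L : Sym2 V → ℝ) {x y : V}
    (p : (⊤ : SimpleGraph V).Walk x y) : ℝ≥0∞ :=
  open Classical in if ∀ e ∈ p.edges, e ∈ G.edgeSet then discount θ (walkLength L p) else 0

/-- The generating function of the lengths of the self-avoiding paths of `G` starting at `x`.
Summing over the paths of the complete graph keeps the index set deterministic if `G` is random. -/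
noncomputable def pathSum (θ : ℝ) (G : SimpleGraph V) (L : Sym2 V → ℝ) (x : V) : ℝ≥0∞ :=
  ∑' p : Σ y, (⊤ : SimpleGraph V).Path x y, pathWeight θ G L p.2.1

end Discount

section Balls

variable {V : Type*} {θ C : ℝ} {G : SimpleGraph V} {L : Sym2 V → ℝ} {x y : V}

theorem ballL_mono (G : SimpleGraph V) (L : Sym2 V → ℝ) (x : V) : Monotone (ballL G L x) :=
  fun _ _ hst _ hy => le_trans hy (ENNReal.coe_le_coe.2 hst)

theorem discount_le_tsum_pathWeight (hθ : 0 ≤ θ) {t r : ℝ≥0} (htr : t < r)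
    (hy : y ∈ ballL G L x t) :
    discount θ r ≤ ∑' p : (⊤ : SimpleGraph V).Path x y, pathWeight θ G L p.1 := by
  obtain ⟨p, hp⟩ := iInf_lt_iff.1 (lt_of_le_of_lt hy (ENNReal.coe_lt_coe.2 htr))
  let q : (⊤ : SimpleGraph V).Path x y := ⟨p.1.mapLe le_top, p.2.mapLe le_top⟩
  have hedges : q.1.edges = p.1.edges := p.1.edges_mapLe_eq_edges le_top
  have hlength : walkLength L q.1 = walkLength L p.1 := by rw [walkLength, hedges, walkLength]
  calc discount θ r ≤ discount θ (walkLength L p.1) :=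
        discount_le_discount hθ hp.le ENNReal.coe_ne_top
    _ = pathWeight θ G L q.1 := by
        rw [pathWeight, if_pos, hlength]
        rw [hedges]
        exact fun e he => p.1.edges_subset_edgeSet he
    _ ≤ ∑' p : (⊤ : SimpleGraph V).Path x y, pathWeight θ G L p.1 := ENNReal.le_tsum q

theorem encard_ballL_mul_discount_le_pathSum (hθ : 0 ≤ θ) {t r : ℝ≥0} (htr : t < r)
    (G : SimpleGraph V) (L : Sym2 V → ℝ) (x : V) :
    ((ballL G L x t).encard : ℝ≥0∞) * discount θ r ≤ pathSum θ G L x :=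
  calc ((ballL G L x t).encard : ℝ≥0∞) * discount θ r
      = ∑' _ : ballL G L x t, discount θ r := (ENNReal.tsum_const _).symm
    _ ≤ ∑' y : ballL G L x t, ∑' p : (⊤ : SimpleGraph V).Path x y, pathWeight θ G L p.1 :=
        ENNReal.tsum_le_tsum fun y => discount_le_tsum_pathWeight hθ htr y.2
    _ ≤ ∑' y, ∑' p : (⊤ : SimpleGraph V).Path x y, pathWeight θ G L p.1 :=
        ENNReal.tsum_comp_le_tsum_of_injective Subtype.val_injective
          fun y => ∑' p : (⊤ : SimpleGraph V).Path x y, pathWeight θ G L p.1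
    _ = pathSum θ G L x :=
        (ENNReal.tsum_sigma fun y (p : (⊤ : SimpleGraph V).Path x y) => pathWeight θ G L p.1).symm

theorem finite_ballL_of_pathSum_ne_top (hθ : 0 ≤ θ) (hZ : pathSum θ G L x ≠ ⊤) (t : ℝ≥0) :
    (ballL G L x t).Finite := by
  rw [← Set.encard_ne_top_iff]
  intro htop
  have hle := encard_ballL_mul_discount_le_pathSum hθ (lt_add_one t) G L x
  rw [htop, ENat.toENNReal_top, ENNReal.top_mul (discount_ne_zero θ _)] at hle
  exact hZ (top_le_iff.1 hle)

theorem ncard_ballL_le_pathSum_mul_exp (hθ : 0 ≤ θ) (hZ : pathSum θ G L x ≠ ⊤) (t : ℝ≥0) :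
    ((ballL G L x t).ncard : ℝ) ≤ (pathSum θ G L x).toReal * Real.exp (θ * (t + 1)) := by
  have hle := encard_ballL_mul_discount_le_pathSum hθ (lt_add_one t) G L x
  rw [← (finite_ballL_of_pathSum_ne_top hθ hZ t).cast_ncard_eq] at hle
  have hreal := ENNReal.toReal_mono hZ hle
  rw [ENNReal.toReal_mul, discount, ENNReal.toReal_ofReal (Real.exp_pos _).le, Real.exp_neg,
    ← div_eq_mul_inv, div_le_iff₀ (Real.exp_pos _)] at hreal
  simpa only [ENat.toENNReal_coe, ENNReal.toReal_natCast, ENNReal.coe_toReal, NNReal.coe_add,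
    NNReal.coe_one] using hreal

/-- The balls around `x` are eventually finite and of size at most `exp (C t)`. -/
def HasExpBallGrowth (C : ℝ) (G : SimpleGraph V) (L : Sym2 V → ℝ) (x : V) : Prop :=
  ∃ t₀ : ℝ≥0, ∀ t : ℝ≥0, t₀ ≤ t →
    (ballL G L x t).Finite ∧ ((ballL G L x t).ncard : ℝ) ≤ Real.exp (C * t)

theorem hasExpBallGrowth_of_pathSum_ne_top (hθ : 0 ≤ θ) (hZ : pathSum θ G L x ≠ ⊤) :
    HasExpBallGrowth (θ + 1) G L x := by
  set z := (pathSum θ G L x).toReal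
  refine ⟨⟨z + θ, add_nonneg ENNReal.toReal_nonneg hθ⟩, fun t ht =>
    ⟨finite_ballL_of_pathSum_ne_top hθ hZ t, ?_⟩⟩
  have hzt : z + θ ≤ t := ht
  calc ((ballL G L x t).ncard : ℝ) ≤ z * Real.exp (θ * (t + 1)) :=
        ncard_ballL_le_pathSum_mul_exp hθ hZ t
    _ ≤ Real.exp z * Real.exp (θ * (t + 1)) := by
        gcongr
        linarith [Real.add_one_le_exp z]
    _ = Real.exp (z + θ * (t + 1)) := (Real.exp_add _ _).symm
    _ ≤ Real.exp ((θ + 1) * t) := by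
        gcongr
        linarith

theorem passTime_le_hitTime (G : SimpleGraph V) (L : Sym2 V → ℝ) (x : V) (n : ℕ) :
    passTime G L x n ≤ hitTime G L x n :=
  le_iInf₂ fun t ht => iInf₂_le t ht.ge

namespace HasExpBallGrowth

theorem finite_ballL (h : HasExpBallGrowth C G L x) (t : ℝ≥0) : (ballL G L x t).Finite := by
  obtain ⟨t₀, h⟩ := h
  exact (h _ (le_max_left t₀ t)).1.subset (ballL_mono G L x (le_max_right t₀ t))

theorem eventually_log_le_passTime (hC : 0 < C) (h : HasExpBallGrowth C G L x) :
    ∀ᶠ n : ℕ in atTop, ENNReal.ofReal (C⁻¹ * Real.log n) ≤ passTime G L x n := by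
  obtain ⟨t₀, h⟩ := h
  have hlarge : ∀ᶠ n : ℕ in atTop, Real.exp (C * t₀) < n :=
    tendsto_natCast_atTop_atTop.eventually_gt_atTop _
  filter_upwards [hlarge] with n hn
  refine le_iInf₂ fun t ht => ?_
  have le_exp : ∀ r : ℝ≥0, t₀ ≤ r → t ≤ r → (n : ℝ) ≤ Real.exp (C * r) := by
    intro r hr htr
    obtain ⟨hfin, hcard⟩ := h r hr
    have hncard : (n : ℕ∞) ≤ (ballL G L x r).ncard := by
      rw [hfin.cast_ncard_eq]
      exact ht.trans (Set.encard_le_encard (ballL_mono G L x htr))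
    exact le_trans (mod_cast hncard) hcard
  have ht₀ : t₀ ≤ t := le_of_not_gt fun hlt => (le_exp t₀ le_rfl hlt.le).not_gt hn
  have hpos : (0 : ℝ) < n := (Real.exp_pos _).trans hn
  rw [← ENNReal.ofReal_coe_nnreal]
  refine ENNReal.ofReal_le_ofReal ((inv_mul_le_iff₀ hC).2 ?_)
  exact (Real.log_le_iff_le_exp hpos).2 (le_exp t ht₀ le_rfl)

theorem tendsto_passTime (hC : 0 < C) (h : HasExpBallGrowth C G L x) :
    Tendsto (passTime G L x) atTop (𝓝 ⊤) := by
  have hlog : Tendsto (fun n : ℕ => ENNReal.ofReal (C⁻¹ * Real.log n)) atTop (𝓝 ⊤) :=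
    ENNReal.tendsto_ofReal_atTop.comp
      ((Real.tendsto_log_atTop.comp tendsto_natCast_atTop_atTop).const_mul_atTop (inv_pos.2 hC))
  exact tendsto_nhds_top_mono hlog (h.eventually_log_le_passTime hC)

theorem tendsto_hitTime (hC : 0 < C) (h : HasExpBallGrowth C G L x) :
    Tendsto (hitTime G L x) atTop (𝓝 ⊤) :=
  tendsto_nhds_top_mono' (h.tendsto_passTime hC) (passTime_le_hitTime G L x)

end HasExpBallGrowth

end Balls

section Moments

variable {ν : Measure ℝ}

theorem antitone_measureReal_Ioi (ν : Measure ℝ) [IsFiniteMeasure ν] :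
    Antitone fun t => ν.real (Ioi t) :=
  fun _ _ hst => measureReal_mono (Ioi_subset_Ioi hst)

theorem integrableOn_tail_mul_rpow [IsFiniteMeasure ν] {p q : ℝ} (hp : 0 < p) (hpq : p < q)
    (htail : (fun t => ν.real (Ioi t)) =O[atTop] fun t : ℝ => t ^ (-q)) :
    IntegrableOn (fun t => ν.real (Ioi t) * t ^ (p - 1)) (Ioi 0) := by
  obtain ⟨K, hK⟩ := htail.bound
  obtain ⟨T, hT⟩ := eventually_atTop.1 (hK.and (eventually_gt_atTop 0))
  have hT0 : 0 < T := (hT T le_rfl).2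
  have hmeas : Measurable fun t => ν.real (Ioi t) * t ^ (p - 1) :=
    (antitone_measureReal_Ioi ν).measurable.mul (by fun_prop)
  have hnear : IntegrableOn (fun t => ν.real (Ioi t) * t ^ (p - 1)) (Ioc 0 T) := by
    have hrpow : IntegrableOn (fun t => t ^ (p - 1)) (Ioc 0 T) :=
      (intervalIntegral.intervalIntegrable_rpow' (by linarith)).1
    refine (hrpow.const_mul (ν.real univ)).mono' hmeas.aestronglyMeasurable ?_
    filter_upwards [ae_restrict_mem measurableSet_Ioc] with t ht
    have ht0 : 0 ≤ t := ht.1.le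
    rw [Real.norm_of_nonneg (by positivity)]
    exact mul_le_mul_of_nonneg_right (measureReal_mono (subset_univ _)) (by positivity)
  have hfar : IntegrableOn (fun t => ν.real (Ioi t) * t ^ (p - 1)) (Ioi T) := by
    have hrpow : IntegrableOn (fun t => t ^ (p - 1 - q)) (Ioi T) :=
      integrableOn_Ioi_rpow_of_lt (by linarith) hT0
    refine (hrpow.const_mul K).mono' hmeas.aestronglyMeasurable ?_
    filter_upwards [ae_restrict_mem measurableSet_Ioi] with t ht
    obtain ⟨hbound, ht0⟩ := hT t (le_of_lt ht)
    rw [Real.norm_of_nonneg measureReal_nonneg, Real.norm_of_nonneg (by positivity)] at hbound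
    calc ‖ν.real (Ioi t) * t ^ (p - 1)‖ = ν.real (Ioi t) * t ^ (p - 1) :=
          Real.norm_of_nonneg (by positivity)
      _ ≤ K * t ^ (-q) * t ^ (p - 1) := by gcongr
      _ = K * t ^ (p - 1 - q) := by
          rw [mul_assoc, ← Real.rpow_add ht0, neg_add_eq_sub]
  rw [← Ioc_union_Ioi_eq_Ioi hT0.le]
  exact hnear.union hfar

theorem integrable_rpow_of_tail_isBigO [IsFiniteMeasure ν] (hν : ∀ᵐ w ∂ν, 0 ≤ w) {p q : ℝ}
    (hp : 0 < p) (hpq : p < q)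
    (htail : (fun t => ν.real (Ioi t)) =O[atTop] fun t : ℝ => t ^ (-q)) :
    Integrable (fun w => w ^ p) ν := by
  have hmeas : Measurable fun w : ℝ => w ^ p := by fun_prop
  rw [← lintegral_ofReal_ne_top_iff_integrable hmeas.aestronglyMeasurable
    (hν.mono fun w hw => Real.rpow_nonneg hw p),
    lintegral_rpow_eq_lintegral_meas_lt_mul ν hν aemeasurable_id hp]
  refine ENNReal.mul_ne_top ENNReal.ofReal_ne_top ?_
  convert (integrableOn_tail_mul_rpow hp hpq htail).lintegral_lt_top.ne using 3 with t
  rw [ENNReal.ofReal_mul measureReal_nonneg, ofReal_measureReal]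
  rfl

theorem isBigO_rpow_neg_of_eventually_two_mul_le {f : ℝ → ℝ} (hf : Antitone f)
    (hf0 : ∀ t, 0 ≤ f t) {q : ℝ} (hq : 0 ≤ q)
    (h : ∀ᶠ t in atTop, f (2 * t) ≤ 2 ^ (-q) * f t) : f =O[atTop] fun t : ℝ => t ^ (-q) := by
  obtain ⟨T, hT⟩ := eventually_atTop.1 (h.and (eventually_gt_atTop 0))
  have hT0 : 0 < T := (hT T le_rfl).2
  have hdyadic (k : ℕ) : f (2 ^ k * T) ≤ (2 ^ (-q)) ^ k * f T := by
    induction k with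
    | zero => simp
    | succ k ih =>
      have hk : T ≤ 2 ^ k * T := le_mul_of_one_le_left hT0.le (one_le_pow₀ one_le_two)
      calc f (2 ^ (k + 1) * T) = f (2 * (2 ^ k * T)) := by ring_nf
        _ ≤ 2 ^ (-q) * f (2 ^ k * T) := (hT _ hk).1
        _ ≤ 2 ^ (-q) * ((2 ^ (-q)) ^ k * f T) := by gcongr
        _ = (2 ^ (-q)) ^ (k + 1) * f T := by ring
  refine Asymptotics.IsBigO.of_bound ((2 * T) ^ q * f T) ?_
  filter_upwards [eventually_ge_atTop T] with t ht
  have ht0 : 0 < t := hT0.trans_le ht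
  obtain ⟨k, hk, hk'⟩ := exists_nat_pow_near ((one_le_div hT0).2 ht) one_lt_two
  rw [le_div_iff₀ hT0] at hk
  rw [div_lt_iff₀ hT0] at hk'
  have hpow : t / (2 * T) ≤ 2 ^ k := by
    rw [div_le_iff₀ (by positivity), ← mul_assoc, ← pow_succ]
    exact hk'.le
  rw [Real.norm_of_nonneg (hf0 t), Real.norm_of_nonneg (by positivity)]
  calc f t ≤ f (2 ^ k * T) := hf hk
    _ ≤ (2 ^ (-q)) ^ k * f T := hdyadic k
    _ = (2 ^ k) ^ (-q) * f T := by rw [Real.rpow_pow_comm two_pos.le]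
    _ ≤ (t / (2 * T)) ^ (-q) * f T := by
        gcongr ?_ * _
        · exact hf0 T
        · exact Real.rpow_le_rpow_of_nonpos (by positivity) hpow (neg_nonpos.2 hq)
    _ = (2 * T) ^ q * f T * t ^ (-q) := by
        rw [Real.div_rpow ht0.le (by positivity), Real.rpow_neg (by positivity : 0 ≤ 2 * T),
          div_inv_eq_mul]
        ring

theorem IsPowerLaw.tail_isBigO [IsFiniteMeasure ν] {τ q : ℝ} (h : IsPowerLaw ν τ) (hq : 0 ≤ q)
    (hqτ : q < τ - 1) : (fun t => ν.real (Ioi t)) =O[atTop] fun t : ℝ => t ^ (-q) := by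
  obtain ⟨ℓ, hℓ, htail⟩ := h
  refine isBigO_rpow_neg_of_eventually_two_mul_le (antitone_measureReal_Ioi ν)
    (fun _ => measureReal_nonneg) hq ?_
  have hratio : Tendsto (fun t => ν.real (Ioi (2 * t)) / ν.real (Ioi t)) atTop
      (𝓝 (2 ^ (-(τ - 1)))) := by
    have hlim := (hℓ 2 two_pos).mul_const ((2 : ℝ) ^ (-(τ - 1)))
    rw [one_mul] at hlim
    refine hlim.congr' ?_
    filter_upwards [eventually_gt_atTop 0] with t ht
    rw [htail t ht, htail (2 * t) (by positivity), Real.mul_rpow two_pos.le ht.le,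
      Real.rpow_neg two_pos.le]
    have : t ^ (τ - 1) ≠ 0 := (Real.rpow_pos_of_pos ht _).ne'
    rcases eq_or_ne (ℓ t) 0 with h0 | h0
    · simp [h0]
    · field_simp
  have hlt : (2 : ℝ) ^ (-(τ - 1)) < 2 ^ (-q) :=
    Real.rpow_lt_rpow_of_exponent_lt one_lt_two (neg_lt_neg hqτ)
  filter_upwards [hratio.eventually_le_const hlt, eventually_ge_atTop 0] with t ht ht0
  rcases (measureReal_nonneg (μ := ν) (s := Ioi t)).eq_or_lt with h0 | hpos
  · rw [← h0, mul_zero, h0]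
    exact antitone_measureReal_Ioi ν (by linarith)
  · rwa [div_le_iff₀ hpos] at ht

theorem IsThinTailed.tail_isBigO (h : IsThinTailed ν) {q : ℝ} (hq : 0 < q) :
    (fun t => ν.real (Ioi t)) =O[atTop] fun t : ℝ => t ^ (-q) := by
  refine Asymptotics.IsBigO.of_bound 1 ?_
  filter_upwards [(h q hq).eventually_le_const one_pos, eventually_gt_atTop 0] with t ht ht0
  have htq : 0 < t ^ q := Real.rpow_pos_of_pos ht0 q
  rw [Real.norm_of_nonneg measureReal_nonneg, Real.norm_of_nonneg (by positivity), one_mul,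
    Real.rpow_neg ht0.le, ← one_div, le_div_iff₀' htq]
  exact ht

/-- In the power-law case the requirement `γ > 2` says that the exponent `2 d / α` lies below
`τ - 1`, the threshold for finite moments. -/
theorem exists_integrable_rpow_of_tail [IsFiniteMeasure ν] (hν : ∀ᵐ w ∂ν, 0 ≤ w) {α D : ℝ}
    (hα : 0 < α) (hD : 0 < D)
    (hγ : (∃ τ : ℝ, IsPowerLaw ν τ ∧ 2 < α * (τ - 1) / D) ∨ IsThinTailed ν) :
    ∃ p : ℝ, 2 * D < α * p ∧ Integrable (fun w => w ^ p) ν := by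
  have hp₀ : 0 < 2 * D / α := by positivity
  suffices h : ∃ q, 2 * D / α < q ∧ (fun t => ν.real (Ioi t)) =O[atTop] fun t : ℝ => t ^ (-q) by
    obtain ⟨q, hq, htail⟩ := h
    obtain ⟨p, hp, hpq⟩ := exists_between hq
    exact ⟨p, (div_lt_iff₀' hα).1 hp,
      integrable_rpow_of_tail_isBigO hν (hp₀.trans hp) hpq htail⟩
  rcases hγ with ⟨τ, hpower, hτ⟩ | hthin
  · have hlt : 2 * D / α < τ - 1 := by
      rwa [div_lt_iff₀' hα, ← lt_div_iff₀ hD]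
    obtain ⟨q, hq, hqτ⟩ := exists_between hlt
    exact ⟨q, hq, hpower.tail_isBigO (hp₀.trans hq).le hqτ⟩
  · exact ⟨2 * D / α + 1, lt_add_one _, hthin.tail_isBigO (by positivity)⟩

theorem ae_pos_of_cdf_zero [IsProbabilityMeasure ν] (h : cdf ν 0 = 0) : ∀ᵐ r ∂ν, 0 < r := by
  rw [cdf_eq_real, measureReal_eq_zero_iff] at h
  simpa [ae_iff, Iic] using h

/-- The Laplace transform `E exp (-θ L)` of a law `ν` of edge-weights `L`. -/
noncomputable def meanDiscount (θ : ℝ) (ν : Measure ℝ) : ℝ≥0∞ :=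
  ∫⁻ r, discount θ (ENNReal.ofReal r) ∂ν

theorem tendsto_meanDiscount [IsFiniteMeasure ν] (hν : ∀ᵐ r ∂ν, 0 < r) :
    Tendsto (fun θ => meanDiscount θ ν) atTop (𝓝 0) := by
  have hlim : ∀ᵐ r ∂ν, Tendsto (fun θ => discount θ (ENNReal.ofReal r)) atTop (𝓝 0) := by
    filter_upwards [hν] with r hr
    have hexp : Tendsto (fun θ => Real.exp (-(θ * r))) atTop (𝓝 0) :=
      Real.tendsto_exp_neg_atTop_nhds_zero.comp (tendsto_id.atTop_mul_const hr)
    simpa [discount, ENNReal.toReal_ofReal hr.le] using ENNReal.tendsto_ofReal hexp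
  have hbound : ∀ᶠ θ in atTop, ∀ᵐ r ∂ν, discount θ (ENNReal.ofReal r) ≤ 1 := by
    filter_upwards [eventually_ge_atTop 0] with θ hθ
    exact Eventually.of_forall fun r => discount_le_one hθ _
  simpa [meanDiscount] using tendsto_lintegral_filter_of_dominated_convergence (fun _ => 1)
    (Eventually.of_forall fun θ => by fun_prop) hbound (by simp) hlim

theorem exists_mul_meanDiscount_lt_one [IsFiniteMeasure ν] (hν : ∀ᵐ r ∂ν, 0 < r)
    {K : ℝ≥0∞} (hK : K ≠ ⊤) : ∃ θ : ℝ, 0 ≤ θ ∧ K * meanDiscount θ ν < 1 := by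
  have hlim := ENNReal.Tendsto.const_mul (tendsto_meanDiscount hν) (Or.inr hK)
  rw [mul_zero] at hlim
  exact ((eventually_ge_atTop 0).and (hlim.eventually_lt_const one_pos)).exists

end Moments

section EdgeProbabilities

variable {d : ℕ} {α lam s : ℝ}

theorem one_le_eucl {x y : Lattice d} (h : x ≠ y) : 1 ≤ eucl x y := by
  obtain ⟨i, hi⟩ := Function.ne_iff.1 h
  have hcoord : (1 : ℝ) ≤ ((x i : ℝ) - y i) ^ 2 := by
    rw [one_le_sq_iff_one_le_abs]
    exact_mod_cast Int.one_le_abs (sub_ne_zero.2 hi)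
  rw [eucl, Real.one_le_sqrt]
  exact hcoord.trans (Finset.single_le_sum (f := fun i => ((x i : ℝ) - y i) ^ 2)
    (fun i _ => sq_nonneg _) (Finset.mem_univ i))

theorem eucl_eq_eucl_zero_sub (x y : Lattice d) : eucl x y = eucl 0 (y - x) := by
  rw [eucl_comm, eucl_comm 0, eucl, eucl]
  simp

theorem summable_eucl_zero_rpow {p : ℝ} (hp : d < p) :
    Summable fun y : Lattice d => eucl 0 y ^ (-p) := by
  let b := (EuclideanSpace.basisFun (Fin d) ℝ).toBasis
  let Λ := Submodule.span ℤ (Set.range b)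
  have hrank : Module.finrank ℤ Λ = d := by
    rw [ZLattice.rank ℝ Λ, finrank_euclideanSpace_fin]
  have hsum : Summable fun z : Λ => ‖z‖ ^ (-p) :=
    ZLattice.summable_norm_rpow Λ (-p) (by rw [hrank]; exact neg_lt_neg hp)
  let toLattice (y : Lattice d) : Λ := ⟨WithLp.toLp 2 fun i => (y i : ℝ),
    (b.mem_span_iff_repr_mem ℤ _).2 fun i => ⟨y i, by simp [b]⟩⟩
  have hinj : Function.Injective toLattice := fun y z hyz => by
    have hvec := WithLp.toLp_injective 2 (congrArg Subtype.val hyz)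
    exact funext fun i => Int.cast_injective (congrFun hvec i)
  have hnorm (y : Lattice d) : ‖toLattice y‖ = eucl 0 y := by
    simp [toLattice, eucl, EuclideanSpace.norm_eq]
  simpa only [Function.comp_def, hnorm] using hsum.comp_injective hinj

/-- The spatial factor `(max lam 1 / ‖x - y‖ ^ α) ^ s` of the bound on edge probabilities; it
vanishes on the diagonal for `α, s ≠ 0`. The maximum makes it at least `1` for nearest neighbours,
which are joined with certainty. -/
noncomputable def edgeKernel (α lam s : ℝ) : Sym2 (Lattice d) → ℝ≥0∞ :=
  Sym2.lift ⟨fun x y => ENNReal.ofReal ((max lam 1 / eucl x y ^ α) ^ s), fun x y => by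
    simp only [eucl_comm x y]⟩

/-- The sum of `edgeKernel` over the pairs containing a fixed vertex, by translation invariance the
same for every vertex. -/
noncomputable def kernelMass (d : ℕ) (α lam s : ℝ) : ℝ≥0∞ :=
  ∑' y : Lattice d, edgeKernel α lam s s(0, y)

theorem tsum_edgeKernel (α lam s : ℝ) (x : Lattice d) :
    ∑' y, edgeKernel α lam s s(x, y) = kernelMass d α lam s := by
  rw [kernelMass, ← (Equiv.subRight x).tsum_eq fun y => edgeKernel α lam s s(0, y)]
  simp only [edgeKernel, Sym2.lift_mk, eucl_eq_eucl_zero_sub x, Equiv.subRight_apply]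

theorem kernelMass_ne_top (h : d < α * s) : kernelMass d α lam s ≠ ⊤ := by
  refine Summable.tsum_ofReal_ne_top (((summable_eucl_zero_rpow h).mul_left (max lam 1 ^ s)).congr
    fun y => ?_)
  have hy : 0 ≤ eucl 0 y := Real.sqrt_nonneg _
  rw [Real.div_rpow (by positivity) (by positivity), ← Real.rpow_mul hy, Real.rpow_neg hy,
    div_eq_mul_inv]

/-- The factor `max r 1 ^ s` that a vertex of weight `r` contributes to the bound on the probability
of each of its edges. -/
noncomputable def weightFactor (s r : ℝ) : ℝ≥0∞ :=
  ENNReal.ofReal (max r 1 ^ s)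

@[fun_prop]
theorem measurable_weightFactor (s : ℝ) : Measurable (weightFactor s) := by
  unfold weightFactor
  fun_prop

theorem one_le_weightFactor (hs : 0 ≤ s) (r : ℝ) : 1 ≤ weightFactor s r :=
  ENNReal.one_le_ofReal.2 (Real.one_le_rpow (le_max_right r 1) hs)

theorem one_sub_exp_neg_le_rpow {z : ℝ} (hz : 0 ≤ z) (hs0 : 0 ≤ s) (hs1 : s ≤ 1) :
    1 - Real.exp (-z) ≤ z ^ s := by
  rcases le_total z 1 with h | h
  · calc 1 - Real.exp (-z) ≤ z := by linarith [Real.add_one_le_exp (-z)]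
      _ ≤ z ^ s := Real.self_le_rpow_of_le_one hz h hs1
  · linarith [Real.one_le_rpow h hs0, Real.exp_pos (-z)]

theorem edgeProb_nonneg (hlam : 0 ≤ lam) {w : Lattice d → ℝ} (hw : ∀ v, 0 ≤ w v)
    (e : Sym2 (Lattice d)) : 0 ≤ edgeProb α lam w e := by
  induction e with | _ x y
  have hx := hw x
  have hy := hw y
  have hxy : 0 ≤ eucl x y := Real.sqrt_nonneg _
  simp only [edgeProb, Sym2.lift_mk, sub_nonneg, Real.exp_le_one_iff, neg_nonpos]
  positivity

theorem edgeKernel_mul_weightFactors (α lam s : ℝ) (w : Lattice d → ℝ) (x y : Lattice d) :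
    edgeKernel α lam s s(x, y) * ((s(x, y)).map fun v => weightFactor s (w v)).mul =
      ENNReal.ofReal ((max lam 1 / eucl x y ^ α * (max (w x) 1 * max (w y) 1)) ^ s) := by
  have hxy : 0 ≤ eucl x y := Real.sqrt_nonneg _
  rw [Sym2.map_mk, Sym2.mul_mk, edgeKernel, Sym2.lift_mk, weightFactor, weightFactor,
    Real.mul_rpow (by positivity) (by positivity), Real.mul_rpow (by positivity) (by positivity),
    ENNReal.ofReal_mul (by positivity), ENNReal.ofReal_mul (by positivity)]

theorem ofReal_edgeProb_le (hlam : 0 ≤ lam) (hs0 : 0 ≤ s) (hs1 : s ≤ 1) {w : Lattice d → ℝ}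
    (hw : ∀ v, 0 ≤ w v) (e : Sym2 (Lattice d)) :
    ENNReal.ofReal (edgeProb α lam w e) ≤
      edgeKernel α lam s e * (e.map fun v => weightFactor s (w v)).mul := by
  induction e with | _ x y
  have hx := hw x
  have hy := hw y
  have hxy : 0 ≤ eucl x y := Real.sqrt_nonneg _
  rw [edgeKernel_mul_weightFactors, edgeProb, Sym2.lift_mk]
  refine ENNReal.ofReal_le_ofReal ?_
  calc 1 - Real.exp (-(lam * (w x * w y) / eucl x y ^ α))
      ≤ (lam * (w x * w y) / eucl x y ^ α) ^ s :=
        one_sub_exp_neg_le_rpow (by positivity) hs0 hs1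
    _ ≤ (max lam 1 / eucl x y ^ α * (max (w x) 1 * max (w y) 1)) ^ s := by
        rw [mul_div_right_comm]
        gcongr <;> exact le_max_left _ _

theorem one_le_edgeKernel_mul_of_not_isLong (hs : 0 ≤ s) (w : Lattice d → ℝ)
    {e : Sym2 (Lattice d)} (hdiag : ¬ e.IsDiag) (hlong : ¬ IsLong e) :
    1 ≤ edgeKernel α lam s e * (e.map fun v => weightFactor s (w v)).mul := by
  induction e with | _ x y
  have hxy : eucl x y = 1 := le_antisymm (not_lt.1 fun hlt => hlong ⟨x, y, rfl, hlt⟩)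
    (one_le_eucl (by simpa using hdiag))
  rw [edgeKernel_mul_weightFactors, hxy, Real.one_rpow, div_one, ENNReal.one_le_ofReal]
  exact Real.one_le_rpow (one_le_mul_of_one_le_of_one_le (le_max_right _ _)
    (one_le_mul_of_one_le_of_one_le (le_max_right _ _) (le_max_right _ _))) hs

open Classical in
theorem prod_ofReal_edgeProb_le (hlam : 0 ≤ lam) (hs0 : 0 ≤ s) (hs1 : s ≤ 1) {w : Lattice d → ℝ}
    (hw : ∀ v, 0 ≤ w v) {x y : Lattice d} {p : (⊤ : SimpleGraph (Lattice d)).Walk x y}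
    (hp : p.IsTrail) :
    ∏ e ∈ p.edges.toFinset with IsLong e, ENNReal.ofReal (edgeProb α lam w e) ≤
      (p.edges.map (edgeKernel α lam s)).prod *
        (p.support.map fun v => weightFactor s (w v) ^ 2).prod := by
  set u : Lattice d → ℝ≥0∞ := fun v => weightFactor s (w v)
  have hu (v : Lattice d) : 1 ≤ u v := one_le_weightFactor hs0 _
  calc ∏ e ∈ p.edges.toFinset with IsLong e, ENNReal.ofReal (edgeProb α lam w e)
      ≤ ∏ e ∈ p.edges.toFinset, edgeKernel α lam s e * (e.map u).mul := by
        rw [Finset.prod_filter]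
        refine Finset.prod_le_prod' fun e he => ?_
        split_ifs with hlong
        · exact ofReal_edgeProb_le hlam hs0 hs1 hw e
        · have hedge := p.edges_subset_edgeSet (List.mem_toFinset.1 he)
          exact one_le_edgeKernel_mul_of_not_isLong hs0 w
            (SimpleGraph.not_isDiag_of_mem_edgeSet _ hedge) hlong
    _ = (p.edges.map (edgeKernel α lam s)).prod * (p.edges.map fun e => (e.map u).mul).prod := by
        rw [List.prod_toFinset _ hp.edges_nodup, List.prod_map_mul]
    _ ≤ (p.edges.map (edgeKernel α lam s)).prod * (p.support.map fun v => u v ^ 2).prod := by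
        gcongr
        exact (le_mul_of_one_le_left' (hu x)).trans (mul_prod_edges_le_prod_support_sq hu p)

/-- The second moment of the vertex factors `weightFactor s`, that is, essentially the moment of
order `2 s` of a law `ν` of vertex-weights. -/
noncomputable def weightMoment (s : ℝ) (ν : Measure ℝ) : ℝ≥0∞ :=
  ∫⁻ w, weightFactor s w ^ 2 ∂ν

theorem exists_edge_exponent {D p : ℝ} (hD : 0 ≤ D) (hα : D < α) (hp : 2 * D < α * p) :
    ∃ s : ℝ, 0 ≤ s ∧ s ≤ 1 ∧ 2 * s ≤ p ∧ D < α * s := by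
  have hp0 : 0 < p := pos_of_mul_pos_right (by linarith) (hD.trans hα.le)
  refine ⟨min (p / 2) 1, by positivity, min_le_right _ _, ?_, ?_⟩
  · linarith [min_le_left (p / 2) 1]
  · rcases min_choice (p / 2) 1 with hs | hs <;> rw [hs] <;> linarith

theorem weightFactor_sq_le {p w : ℝ} (hsp : 2 * s ≤ p) (hw : 0 ≤ w) :
    weightFactor s w ^ 2 ≤ ENNReal.ofReal (1 + w ^ p) := by
  rw [weightFactor, ← ENNReal.ofReal_pow (by positivity), ← Real.rpow_mul_natCast (by positivity)]
  refine ENNReal.ofReal_le_ofReal ?_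
  push_cast
  rw [mul_comm s]
  rcases le_total w 1 with h | h
  · simpa [max_eq_right h] using Real.rpow_nonneg hw p
  · rw [max_eq_left h]
    linarith [Real.rpow_le_rpow_of_exponent_le h hsp]

theorem weightMoment_ne_top {ν : Measure ℝ} [IsFiniteMeasure ν] (hν : ∀ᵐ w ∂ν, 0 ≤ w) {p : ℝ}
    (hsp : 2 * s ≤ p) (hint : Integrable (fun w => w ^ p) ν) :
    weightMoment s ν ≠ ⊤ := by
  have hint' : Integrable (fun w => 1 + w ^ p) ν := (integrable_const 1).add hint
  exact ne_top_of_le_ne_top hint'.lintegral_lt_top.ne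
    (lintegral_mono_ae (hν.mono fun w hw => weightFactor_sq_le hsp hw))

end EdgeProbabilities

section Percolation

theorem lintegral_list_prod_of_iid {Ω ι β : Type*} [MeasurableSpace Ω] [MeasurableSpace β]
    {μ : Measure Ω} {ν : Measure β} {X : ι → Ω → β} (hindep : iIndepFun X μ)
    (hX : ∀ i, Measurable (X i)) (hlaw : ∀ i, μ.map (X i) = ν) {f : β → ℝ≥0∞} (hf : Measurable f)
    {l : List ι} (hl : l.Nodup) :
    ∫⁻ ω, (l.map fun i => f (X i ω)).prod ∂μ = (∫⁻ b, f b ∂ν) ^ l.length := by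
  classical
  have hfactor (i : ι) : ∫⁻ ω, f (X i ω) ∂μ = ∫⁻ b, f b ∂ν := by
    rw [← hlaw i, lintegral_map hf (hX i)]
  have hprod := lintegral_prod_eq_prod_lintegral_of_indepFun l.toFinset (fun i ω => f (X i ω))
    (hindep.comp (fun _ => f) fun _ => hf) fun i => hf.comp (hX i)
  simpa only [List.prod_toFinset _ hl, hfactor, List.map_const', List.prod_replicate] using hprod

theorem measure_eq_lintegral_of_condExp_indicator {Ω : Type*} {m m₀ : MeasurableSpace Ω}
    {μ : Measure Ω} [IsFiniteMeasure μ] (hm : m ≤ m₀) {A : Set Ω} (hA : MeasurableSet A)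
    {f : Ω → ℝ} (hf : μ[A.indicator (fun _ => (1 : ℝ)) | m] =ᵐ[μ] f) :
    μ A = ∫⁻ ω, ENNReal.ofReal (f ω) ∂μ := by
  have hnonneg : 0 ≤ᵐ[μ] μ[A.indicator (fun _ => (1 : ℝ)) | m] :=
    condExp_nonneg (Eventually.of_forall (indicator_nonneg fun _ _ => zero_le_one))
  rw [← ofReal_integral_eq_lintegral_ofReal (integrable_condExp.congr hf) (hnonneg.trans hf.le),
    ← integral_congr_ae hf, integral_condExp hm, integral_indicator_const _ hA, smul_eq_mul,
    mul_one, ofReal_measureReal]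

variable {Ω : Type u} {d : ℕ}

theorem measurableSet_subset_edgeSet (G : Ω → SimpleGraph (Lattice d))
    (S : Set (Sym2 (Lattice d))) : MeasurableSet[sigmaGraph G] {ω | S ⊆ (G ω).edgeSet} := by
  simp only [Set.subset_def, Set.ofPred_forall]
  refine MeasurableSet.biInter S.to_countable fun e _ => ?_
  induction e with | _ x y
  exact MeasurableSpace.measurableSet_generateFrom ⟨x, y, rfl⟩

theorem measurable_discount_walkLength (θ : ℝ) (L : Sym2 (Lattice d) → Ω → ℝ)
    {G : SimpleGraph (Lattice d)} {x y : Lattice d} (p : G.Walk x y) :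
    Measurable[sigmaLengths L] fun ω => discount θ (walkLength (fun e => L e ω) p) := by
  have hL (e : Sym2 (Lattice d)) : Measurable[sigmaLengths L] (L e) :=
    (comap_measurable (L e)).mono
      (le_iSup (fun e => MeasurableSpace.comap (L e) inferInstance) e) le_rfl
  have hlengths : ∀ f ∈ p.edges.map fun e ω => ENNReal.ofReal (L e ω),
      Measurable[sigmaLengths L] f :=
    List.forall_mem_map.2 fun e _ => (hL e).ennreal_ofReal
  have hsum : Measurable[sigmaLengths L] fun ω => walkLength (fun e => L e ω) p := by
    simpa only [walkLength, List.map_map, Function.comp_def] using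
      List.measurable_fun_sum _ hlengths
  exact (measurable_discount θ).comp hsum

namespace IsScaleFreePercolation

variable [MeasurableSpace Ω] {μ : Measure Ω} {α lam s θ : ℝ} {νW νL : Measure ℝ}
  {W : Lattice d → Ω → ℝ} {G : Ω → SimpleGraph (Lattice d)} {L : Sym2 (Lattice d) → Ω → ℝ}
  {x y : Lattice d}

theorem sigmaWeights_le (h : IsScaleFreePercolation μ α lam νW νL W G L) :
    sigmaWeights W ≤ ‹MeasurableSpace Ω› :=
  iSup_le fun x => (h.measurable_weight x).comap_le

theorem sigmaLengths_le (h : IsScaleFreePercolation μ α lam νW νL W G L) :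
    sigmaLengths L ≤ ‹MeasurableSpace Ω› :=
  iSup_le fun e => (h.measurable_length e).comap_le

theorem sigmaGraph_le (h : IsScaleFreePercolation μ α lam νW νL W G L) :
    sigmaGraph G ≤ ‹MeasurableSpace Ω› := by
  refine MeasurableSpace.generateFrom_le ?_
  rintro _ ⟨x, y, rfl⟩
  exact h.measurable_adj x y

theorem ae_forall_weight (h : IsScaleFreePercolation μ α lam νW νL W G L) {P : ℝ → Prop}
    (hP : ∀ᵐ w ∂νW, P w) : ∀ᵐ ω ∂μ, ∀ v, P (W v ω) := by
  refine ae_all_iff.2 fun v => ae_of_ae_map (h.measurable_weight v).aemeasurable ?_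
  rwa [h.law_weight v]

theorem measure_edges_eq_lintegral [IsFiniteMeasure μ]
    (h : IsScaleFreePercolation μ α lam νW νL W G L) {F : Finset (Sym2 (Lattice d))}
    (hF : ∀ e ∈ F, IsLong e) :
    μ {ω | ∀ e ∈ F, e ∈ (G ω).edgeSet} =
      ∫⁻ ω, ENNReal.ofReal (∏ e ∈ F, edgeProb α lam (fun v => W v ω) e) ∂μ :=
  measure_eq_lintegral_of_condExp_indicator h.sigmaWeights_le
    (h.sigmaGraph_le _ (measurableSet_subset_edgeSet G F)) (h.cond_edges F hF)

theorem measure_path_le [IsFiniteMeasure μ] (h : IsScaleFreePercolation μ α lam νW νL W G L)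
    (hW : ∀ᵐ w ∂νW, 0 ≤ w) (hlam : 0 ≤ lam) (hs0 : 0 ≤ s) (hs1 : s ≤ 1)
    {p : (⊤ : SimpleGraph (Lattice d)).Walk x y} (hp : p.IsPath) :
    μ {ω | ∀ e ∈ p.edges, e ∈ (G ω).edgeSet} ≤
      (p.edges.map (edgeKernel α lam s)).prod * weightMoment s νW ^ (p.length + 1) := by
  classical
  have hmeas : Measurable fun ω => (p.support.map fun v => weightFactor s (W v ω) ^ 2).prod := by
    have hW := h.measurable_weight
    simp only [← List.prod_toFinset _ hp.support_nodup]
    fun_prop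
  calc μ {ω | ∀ e ∈ p.edges, e ∈ (G ω).edgeSet}
      ≤ μ {ω | ∀ e ∈ p.edges.toFinset.filter IsLong, e ∈ (G ω).edgeSet} :=
        measure_mono fun ω hω e he => hω e (List.mem_toFinset.1 (Finset.mem_filter.1 he).1)
    _ = ∫⁻ ω, ENNReal.ofReal
          (∏ e ∈ p.edges.toFinset with IsLong e, edgeProb α lam (fun v => W v ω) e) ∂μ :=
        h.measure_edges_eq_lintegral fun e he => (Finset.mem_filter.1 he).2
    _ ≤ ∫⁻ ω, (p.edges.map (edgeKernel α lam s)).prod *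
          (p.support.map fun v => weightFactor s (W v ω) ^ 2).prod ∂μ := by
        refine lintegral_mono_ae ((h.ae_forall_weight hW).mono fun ω hω => ?_)
        rw [ENNReal.ofReal_prod_of_nonneg fun e _ => edgeProb_nonneg hlam hω e]
        exact prod_ofReal_edgeProb_le hlam hs0 hs1 hω hp.isTrail
    _ = (p.edges.map (edgeKernel α lam s)).prod * weightMoment s νW ^ (p.length + 1) := by
        rw [lintegral_const_mul _ hmeas, lintegral_list_prod_of_iid h.indep_weight
          h.measurable_weight h.law_weight ((measurable_weightFactor s).pow_const 2)
          hp.support_nodup, p.length_support, weightMoment]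

theorem aemeasurable_pathWeight (h : IsScaleFreePercolation μ α lam νW νL W G L) (θ : ℝ)
    (p : (⊤ : SimpleGraph (Lattice d)).Walk x y) :
    AEMeasurable (fun ω => pathWeight θ (G ω) (fun e => L e ω) p) μ :=
  (Measurable.ite (h.sigmaGraph_le _ (measurableSet_subset_edgeSet G {e | e ∈ p.edges}))
    ((measurable_discount_walkLength θ L p).mono h.sigmaLengths_le le_rfl)
    measurable_const).aemeasurable

theorem lintegral_pathWeight (h : IsScaleFreePercolation μ α lam νW νL W G L) (θ : ℝ)
    {p : (⊤ : SimpleGraph (Lattice d)).Walk x y} (hp : p.IsTrail) :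
    ∫⁻ ω, pathWeight θ (G ω) (fun e => L e ω) p ∂μ =
      μ {ω | ∀ e ∈ p.edges, e ∈ (G ω).edgeSet} * meanDiscount θ νL ^ p.length := by
  set A := {ω | ∀ e ∈ p.edges, e ∈ (G ω).edgeSet}
  have hA : MeasurableSet[sigmaGraph G] A := measurableSet_subset_edgeSet G {e | e ∈ p.edges}
  have hindicator : Measurable[sigmaWeights W ⊔ sigmaGraph G] (A.indicator (1 : Ω → ℝ≥0∞)) :=
    measurable_const.indicator (le_sup_right (a := sigmaWeights W) _ hA)
  calc ∫⁻ ω, pathWeight θ (G ω) (fun e => L e ω) p ∂μ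
      = ∫⁻ ω, A.indicator 1 ω * discount θ (walkLength (fun e => L e ω) p) ∂μ := by
        congr with ω
        by_cases hω : ∀ e ∈ p.edges, e ∈ (G ω).edgeSet
        · rw [pathWeight, if_pos hω, indicator_of_mem (show ω ∈ A from hω), Pi.one_apply, one_mul]
        · rw [pathWeight, if_neg hω, indicator_of_notMem (show ω ∉ A from hω), zero_mul]
    _ = μ A * ∫⁻ ω, discount θ (walkLength (fun e => L e ω) p) ∂μ := by
        rw [lintegral_mul_eq_lintegral_mul_lintegral_of_independent_measurableSpace
          (sup_le h.sigmaWeights_le h.sigmaGraph_le) h.sigmaLengths_le h.indep_graph_length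
          hindicator (measurable_discount_walkLength θ L p),
          lintegral_indicator_one (h.sigmaGraph_le _ hA)]
    _ = μ A * meanDiscount θ νL ^ p.length := by
        simp only [discount_walkLength]
        rw [lintegral_list_prod_of_iid h.indep_length h.measurable_length h.law_length
          (f := fun r => discount θ (ENNReal.ofReal r)) (by fun_prop) hp.edges_nodup,
          p.length_edges, meanDiscount]

theorem lintegral_pathWeight_le [IsFiniteMeasure μ]
    (h : IsScaleFreePercolation μ α lam νW νL W G L) (hW : ∀ᵐ w ∂νW, 0 ≤ w) (hlam : 0 ≤ lam)
    (hs0 : 0 ≤ s) (hs1 : s ≤ 1) (θ : ℝ) {p : (⊤ : SimpleGraph (Lattice d)).Walk x y}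
    (hp : p.IsPath) :
    ∫⁻ ω, pathWeight θ (G ω) (fun e => L e ω) p ∂μ ≤ weightMoment s νW *
      (p.edges.map fun e => edgeKernel α lam s e * (weightMoment s νW * meanDiscount θ νL)).prod :=
  calc ∫⁻ ω, pathWeight θ (G ω) (fun e => L e ω) p ∂μ
      = μ {ω | ∀ e ∈ p.edges, e ∈ (G ω).edgeSet} * meanDiscount θ νL ^ p.length :=
        h.lintegral_pathWeight θ hp.isTrail
    _ ≤ (p.edges.map (edgeKernel α lam s)).prod * weightMoment s νW ^ (p.length + 1) *
          meanDiscount θ νL ^ p.length := by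
        gcongr
        exact h.measure_path_le hW hlam hs0 hs1 hp
    _ = weightMoment s νW * (p.edges.map fun e =>
          edgeKernel α lam s e * (weightMoment s νW * meanDiscount θ νL)).prod := by
        rw [List.prod_map_mul, List.map_const', List.prod_replicate, p.length_edges, mul_pow]
        ring

theorem lintegral_pathSum_le [IsFiniteMeasure μ]
    (h : IsScaleFreePercolation μ α lam νW νL W G L) (hW : ∀ᵐ w ∂νW, 0 ≤ w) (hlam : 0 ≤ lam)
    (hs0 : 0 ≤ s) (hs1 : s ≤ 1) (θ : ℝ) (x : Lattice d) :
    ∫⁻ ω, pathSum θ (G ω) (fun e => L e ω) x ∂μ ≤ weightMoment s νW *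
      (1 - kernelMass d α lam s * (weightMoment s νW * meanDiscount θ νL))⁻¹ := by
  set M := weightMoment s νW
  set k : Sym2 (Lattice d) → ℝ≥0∞ := fun e => edgeKernel α lam s e * (M * meanDiscount θ νL)
  have hk (x : Lattice d) : ∑' y, k s(x, y) ≤ kernelMass d α lam s * (M * meanDiscount θ νL) := by
    rw [ENNReal.tsum_mul_right, tsum_edgeKernel]
  calc ∫⁻ ω, pathSum θ (G ω) (fun e => L e ω) x ∂μ
      = ∑' p : Σ y, (⊤ : SimpleGraph (Lattice d)).Path x y,
          ∫⁻ ω, pathWeight θ (G ω) (fun e => L e ω) p.2.1 ∂μ :=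
        lintegral_tsum fun p => h.aemeasurable_pathWeight θ p.2.1
    _ ≤ ∑' p : Σ y, (⊤ : SimpleGraph (Lattice d)).Path x y, M * (p.2.1.edges.map k).prod :=
        ENNReal.tsum_le_tsum fun p => h.lintegral_pathWeight_le hW hlam hs0 hs1 θ p.2.2
    _ ≤ M * ∑' p : Σ y, (⊤ : SimpleGraph (Lattice d)).Walk x y, (p.2.edges.map k).prod := by
        rw [ENNReal.tsum_mul_left]
        gcongr
        exact ENNReal.tsum_comp_le_tsum_of_injective
          (Function.injective_id.sigma_map fun _ => Subtype.val_injective)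
          fun p : Σ y, (⊤ : SimpleGraph (Lattice d)).Walk x y => (p.2.edges.map k).prod
    _ ≤ M * (1 - kernelMass d α lam s * (M * meanDiscount θ νL))⁻¹ := by
        gcongr
        exact tsum_walk_prod_edges_le hk ⊤ x

theorem ae_pathSum_ne_top [IsFiniteMeasure μ] (h : IsScaleFreePercolation μ α lam νW νL W G L)
    (hW : ∀ᵐ w ∂νW, 0 ≤ w) (hlam : 0 ≤ lam) (hs0 : 0 ≤ s) (hs1 : s ≤ 1)
    (hM : weightMoment s νW ≠ ⊤)
    (hθ : kernelMass d α lam s * (weightMoment s νW * meanDiscount θ νL) < 1) (x : Lattice d) :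
    ∀ᵐ ω ∂μ, pathSum θ (G ω) (fun e => L e ω) x ≠ ⊤ := by
  have hfinite : ∫⁻ ω, pathSum θ (G ω) (fun e => L e ω) x ∂μ ≠ ⊤ :=
    ne_top_of_le_ne_top (ENNReal.mul_ne_top hM (ENNReal.inv_ne_top.2 (tsub_pos_of_lt hθ).ne'))
      (h.lintegral_pathSum_le hW hlam hs0 hs1 θ x)
  have hmeas : AEMeasurable (fun ω => pathSum θ (G ω) (fun e => L e ω) x) μ :=
    AEMeasurable.tsum fun p => h.aemeasurable_pathWeight θ p.2.1
  exact (ae_lt_top' hmeas hfinite).mono fun ω hω => hω.ne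

end IsScaleFreePercolation

end Percolation

end SFP

theorem mainTheorem6_general (d : ℕ) (α lam : ℝ) (hα : (d : ℝ) < α) (hlam : 0 ≤ lam)
    (νW νL : Measure ℝ) [IsFiniteMeasure νW] [IsProbabilityMeasure νL]
    (hW : ∀ᵐ w ∂νW, 0 ≤ w) (p : ℝ) (hp : 2 * d < α * p) (hint : Integrable (fun w => w ^ p) νW)
    (hL0 : cdf νL 0 = 0) :
    ∃ C : ℝ, 0 < C ∧ ∃ c : ℝ, 0 < c ∧
      ∀ (Ω : Type u) [MeasurableSpace Ω] (μ : Measure Ω) [IsProbabilityMeasure μ]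
        (W : SFP.Lattice d → Ω → ℝ) (G : Ω → SimpleGraph (SFP.Lattice d))
        (L : Sym2 (SFP.Lattice d) → Ω → ℝ),
        SFP.IsScaleFreePercolation μ α lam νW νL W G L →
        ∀ x : SFP.Lattice d, ∀ᵐ ω ∂μ,
          (∃ t₀ : ℝ≥0, ∀ t : ℝ≥0, t₀ ≤ t →
            (SFP.ballL (G ω) (fun e => L e ω) x t).Finite ∧
            ((SFP.ballL (G ω) (fun e => L e ω) x t).ncard : ℝ) ≤ Real.exp (C * t)) ∧
          (∃ n₀ : ℕ, ∀ n : ℕ, n₀ ≤ n →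
            ENNReal.ofReal (c * Real.log n) ≤ SFP.hitTime (G ω) (fun e => L e ω) x n ∧
            ENNReal.ofReal (c * Real.log n) ≤ SFP.passTime (G ω) (fun e => L e ω) x n) ∧
          Tendsto (fun n : ℕ => SFP.hitTime (G ω) (fun e => L e ω) x n) atTop (𝓝 ⊤) ∧
          Tendsto (fun n : ℕ => SFP.passTime (G ω) (fun e => L e ω) x n) atTop (𝓝 ⊤) ∧
          (∀ t : ℝ≥0, (SFP.ballL (G ω) (fun e => L e ω) x t).Finite) := by
  obtain ⟨s, hs0, hs1, hsp, hds⟩ := SFP.exists_edge_exponent d.cast_nonneg hα hp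
  have hM : SFP.weightMoment s νW ≠ ⊤ := SFP.weightMoment_ne_top hW hsp hint
  obtain ⟨θ, hθ0, hθ⟩ := SFP.exists_mul_meanDiscount_lt_one (SFP.ae_pos_of_cdf_zero hL0)
    (ENNReal.mul_ne_top (SFP.kernelMass_ne_top (lam := lam) hds) hM)
  rw [mul_assoc] at hθ
  have hC : 0 < θ + 1 := by positivity
  refine ⟨θ + 1, hC, (θ + 1)⁻¹, inv_pos.2 hC, fun Ω _ μ _ W G L h x => ?_⟩
  filter_upwards [h.ae_pathSum_ne_top hW hlam hs0 hs1 hM hθ x] with ω hZ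
  have hgrowth : SFP.HasExpBallGrowth (θ + 1) (G ω) (fun e => L e ω) x :=
    SFP.hasExpBallGrowth_of_pathSum_ne_top hθ0 hZ
  obtain ⟨n₀, hpass⟩ := eventually_atTop.1 (hgrowth.eventually_log_le_passTime hC)
  exact ⟨hgrowth,
    ⟨n₀, fun n hn => ⟨(hpass n hn).trans (SFP.passTime_le_hitTime _ _ x n), hpass n hn⟩⟩,
    hgrowth.tendsto_hitTime hC, hgrowth.tendsto_passTime hC, hgrowth.finite_ballL⟩

theorem mainTheorem6 (d : ℕ) (hd : 1 ≤ d) (α lam : ℝ) (hα : (d : ℝ) < α) (hlam : 0 < lam)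
    (νW νL : Measure ℝ) [IsProbabilityMeasure νW] [IsProbabilityMeasure νL]
    (hW1 : νW (Set.Ici 1) = 1)
    (hγ : (∃ τ : ℝ, 1 < τ ∧ SFP.IsPowerLaw νW τ ∧ 2 < α * (τ - 1) / d) ∨ SFP.IsThinTailed νW)
    (hL0 : cdf νL 0 = 0) :
    ∃ C : ℝ, 0 < C ∧ ∃ c : ℝ, 0 < c ∧
      ∀ (Ω : Type u) [MeasurableSpace Ω] (μ : Measure Ω) [IsProbabilityMeasure μ]
        (W : SFP.Lattice d → Ω → ℝ) (G : Ω → SimpleGraph (SFP.Lattice d))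
        (L : Sym2 (SFP.Lattice d) → Ω → ℝ),
        SFP.IsScaleFreePercolation μ α lam νW νL W G L →
        ∀ x : SFP.Lattice d, ∀ᵐ ω ∂μ,
          -- the ball grows at most exponentially
          (∃ t₀ : ℝ≥0, ∀ t : ℝ≥0, t₀ ≤ t →
            (SFP.ballL (G ω) (fun e => L e ω) x t).Finite ∧
            ((SFP.ballL (G ω) (fun e => L e ω) x t).ncard : ℝ) ≤ Real.exp (C * t)) ∧
          -- logarithmic lower bound
          (∃ n₀ : ℕ, ∀ n : ℕ, n₀ ≤ n →
            ENNReal.ofReal (c * Real.log n) ≤ SFP.hitTime (G ω) (fun e => L e ω) x n ∧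
            ENNReal.ofReal (c * Real.log n) ≤ SFP.passTime (G ω) (fun e => L e ω) x n) ∧
          -- the hitting times tend to infinity
          Tendsto (fun n : ℕ => SFP.hitTime (G ω) (fun e => L e ω) x n) atTop (𝓝 ⊤) ∧
          Tendsto (fun n : ℕ => SFP.passTime (G ω) (fun e => L e ω) x n) atTop (𝓝 ⊤) ∧
          -- no explosion
          (∀ t : ℝ≥0, (SFP.ballL (G ω) (fun e => L e ω) x t).Finite) := by
  have hW : ∀ᵐ w ∂νW, w ∈ Ici 1 := (prob_compl_eq_zero_iff measurableSet_Ici).2 hW1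
  have hW0 : ∀ᵐ w ∂νW, 0 ≤ w := hW.mono fun w hw => zero_le_one.trans hw
  obtain ⟨p, hp, hint⟩ := SFP.exists_integrable_rpow_of_tail hW0
    ((Nat.cast_nonneg d).trans_lt hα) (Nat.cast_pos.2 hd)
    (hγ.imp_left fun ⟨τ, _, hτ⟩ => ⟨τ, hτ⟩)
  exact mainTheorem6_general d α lam hα hlam.le νW νL hW0 p hp hint hL0
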